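/- Let $n \ge 0$ be an integer and let $\mathbb{C}[P]$ be the polynomial ring over $\mathbb{C}$ in the $\binom{n+1}{2}$ entries $p_{ij} = p_{ji}$ of a symmetric $n \times n$ matrix $P = (p_{ij})$ of unknowns. Let $I_n \subseteq \mathbb{C}[P]$ be the ideal generated by the entries of $P^2 - P$ and, for an integer $d$ with $0 \le d \le n$, let $I_{n,d} = I_n + \langle \operatorname{trace}(P) - d \rangle$. The projection Grassmannian is the affine variety $\mathrm{pGr}(d,n) = V(I_{n,d})$, the set of all common zeros of $I_{n,d}$ in the space $\mathbb{C}^{\binom{n+1}{2}}$ of complex symmetric $n \times n$ matrices. Then: 1. The ideal $I_n$ is radical, and the affine scheme $\operatorname{Spec}(\mathbb{C}[P]/I_n)$ is smooth over $\mathbb{C}$. 2. For every $d$ with $0 \le d \le n$, the ideal $I_{n,d}$ is prime, it is equal to the ideal of all polynomials in $\mathbb{C}[P]$ that vanish on $\mathrm{pGr}(d,n)$, and the affine scheme $\operatorname{Spec}(\mathbb{C}[P]/I_{n,d})$ is smooth over $\mathbb{C}$. -/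

import Mathlib

/-- The coordinate ring `ℂ[P]` of the space of symmetric `n × n` matrices: one unknown for each
unordered pair `{i, j}` of indices (with `i = j` allowed), so `n (n + 1) / 2` unknowns. -/
abbrev SymMatRing (n : ℕ) : Type := MvPolynomial (Sym2 (Fin n)) ℂ

/-- The generic symmetric `n × n` matrix `P = (p_{ij})` over `ℂ[P]`, with `p_{ij} = p_{ji}`. -/
noncomputable def genericSymm (n : ℕ) : Matrix (Fin n) (Fin n) (SymMatRing n) :=
  Matrix.of fun i j => MvPolynomial.X s(i, j)

/-- The ideal `I_n` of `ℂ[P]` generated by the entries of `P ^ 2 - P`. -/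
noncomputable def idempotentIdeal (n : ℕ) : Ideal (SymMatRing n) :=
  Ideal.span {f | ∃ i j : Fin n, f = (genericSymm n ^ 2 - genericSymm n) i j}

/-- The ideal `I_{n,d} = I_n + ⟨trace P - d⟩` of `ℂ[P]`. -/
noncomputable def projectionIdeal (d n : ℕ) : Ideal (SymMatRing n) :=
  idempotentIdeal n ⊔ Ideal.span {(genericSymm n).trace - (d : SymMatRing n)}

/-- The projection Grassmannian `pGr(d, n) = V(I_n + ⟨trace P - d⟩)`, as a subset of the complex
affine space of symmetric `n × n` matrices. -/
def pGr (d n : ℕ) : Set (Sym2 (Fin n) → ℂ) :=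
  MvPolynomial.zeroLocus ℂ (projectionIdeal d n)

/-! For an idempotent `E`, the polynomial `det (1 - E + u E)` is multiplicative in `u`. Its
coefficients `e_k` sum to 1 and satisfy `(trace E - k) e_k = 0`, so they split the rank strata over
any `ℂ`-algebra, reduced or not.

Smoothness is infinitesimal lifting: symmetric idempotents lift along square-zero extensions, and
the `e_k` force the trace of the lift to remain `d`.

For primality, `P ↦ Aᵀ (A Aᵀ)⁻¹ A` maps `ℂ[P]` to a domain, and `I_{n,d}` is its kernel: where a
principal `d × d` minor is invertible, `P` is recovered from the corresponding rows, and such minors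
have no common zero on the scheme.

Radicality of `I_n` follows by gluing the prime ideals `I_{n,k}` with the `e_k`; the vanishing ideal
is then the Nullstellensatz. -/

open scoped Matrix

namespace Matrix

/-! ### Rank idempotents and the trace -/

section Idempotent

variable {m S : Type*} [Fintype m] [DecidableEq m] [CommRing S]

/-- The polynomial `det (1 - E + u E)` in the variable `u`. If `E` is idempotent, its
coefficient of degree `k` is the idempotent that cuts out the locus where `E` has rank `k`. -/
noncomputable def rankPoly (E : Matrix m m S) : Polynomial S :=
  det ((Polynomial.X : Polynomial S) • E.map Polynomial.C + (1 - E).map Polynomial.C)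

lemma natDegree_rankPoly_le (E : Matrix m m S) : E.rankPoly.natDegree ≤ Fintype.card m :=
  Polynomial.natDegree_det_X_add_C_le _ _

lemma aeval_rankPoly {T : Type*} [CommRing T] [Algebra S T] (E : Matrix m m S) (u : T) :
    Polynomial.aeval u E.rankPoly =
      det (u • E.map (algebraMap S T) + (1 - E.map (algebraMap S T))) := by
  rw [rankPoly, AlgHom.map_det]
  congr 1
  ext i j
  simp [Matrix.one_apply, apply_ite]
  exact mul_comm _ _

lemma coeff_zero_rankPoly (E : Matrix m m S) : E.rankPoly.coeff 0 = det (1 - E) := by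
  have h := aeval_rankPoly E (0 : S)
  simpa [← Polynomial.coeff_zero_eq_aeval_zero] using h

lemma eval_one_rankPoly (E : Matrix m m S) : E.rankPoly.eval 1 = 1 := by
  have h := aeval_rankPoly E (1 : S)
  simpa [Polynomial.coe_aeval_eq_eval] using h

lemma eval_one_derivative_rankPoly (E : Matrix m m S) :
    E.rankPoly.derivative.eval 1 = E.trace := by
  have h := aeval_rankPoly E (1 + Polynomial.X : Polynomial S)
  have h2 : (1 + Polynomial.X : Polynomial S) • E.map (algebraMap S (Polynomial S)) +
      (1 - E.map (algebraMap S (Polynomial S))) =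
      1 + (Polynomial.X : Polynomial S) • E.map Polynomial.C := by
    rw [add_smul, one_smul, Polynomial.algebraMap_eq]
    abel
  rw [h2] at h
  have h3 := derivative_det_one_add_X_smul E
  rw [← h, ← Polynomial.comp_eq_aeval, Polynomial.derivative_comp] at h3
  simpa using h3

/-- `F` and `1 - F` are orthogonal idempotents, so `(uF + 1 - F)(vF + 1 - F) = uvF + 1 - F`; take
determinants. -/
lemma aeval_mul_rankPoly {T : Type*} [CommRing T] [Algebra S T] {E : Matrix m m S}
    (hE : E * E = E) (u v : T) :
    Polynomial.aeval (u * v) E.rankPoly =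
      Polynomial.aeval u E.rankPoly * Polynomial.aeval v E.rankPoly := by
  have hF : E.map (algebraMap S T) * E.map (algebraMap S T) = E.map (algebraMap S T) := by
    rw [← Matrix.map_mul, hE]
  simp only [aeval_rankPoly, ← det_mul]
  congr 1
  generalize E.map (algebraMap S T) = F at hF
  have h1 : F * (1 - F) = 0 := by rw [mul_sub, mul_one, hF, sub_self]
  have h2 : (1 - F) * F = 0 := by rw [sub_mul, one_mul, hF, sub_self]
  have h3 : (1 - F) * (1 - F) = 1 - F := by rw [mul_sub, h2, mul_one, sub_zero]
  rw [add_mul, mul_add, mul_add, smul_mul_smul_comm, hF, smul_mul_assoc, h1, mul_smul_comm, h2, h3]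
  simp

/-- Compare coefficients of `v ^ k` in the multiplicativity identity, with `u` the inner variable
and `v` the outer one. -/
lemma rankPoly_mul_C_coeff {E : Matrix m m S} (hE : E * E = E) (k : ℕ) :
    E.rankPoly * Polynomial.C (E.rankPoly.coeff k) =
      Polynomial.C (E.rankPoly.coeff k) * Polynomial.X ^ k := by
  have h := congrArg (Polynomial.coeff · k) (aeval_mul_rankPoly hE
    (Polynomial.C Polynomial.X : Polynomial (Polynomial S)) Polynomial.X)
  have h1 : Polynomial.aeval (Polynomial.C Polynomial.X : Polynomial (Polynomial S)) E.rankPoly =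
      Polynomial.C E.rankPoly := by
    have := Polynomial.aeval_algebraMap_apply (Polynomial (Polynomial S))
      (Polynomial.X : Polynomial S) E.rankPoly
    simpa using this
  have h2 : Polynomial.aeval (Polynomial.X : Polynomial (Polynomial S)) E.rankPoly =
      E.rankPoly.map Polynomial.C := by
    rw [Polynomial.aeval_def, Polynomial.map, IsScalarTower.algebraMap_eq S (Polynomial S)]
    rfl
  have h3 : Polynomial.aeval (Polynomial.C Polynomial.X * Polynomial.X :
      Polynomial (Polynomial S)) E.rankPoly =
      ∑ i ∈ Finset.range (E.rankPoly.natDegree + 1),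
        Polynomial.monomial i (Polynomial.C (E.rankPoly.coeff i) * Polynomial.X ^ i) := by
    rw [Polynomial.aeval_eq_sum_range]
    refine Finset.sum_congr rfl fun i _ => ?_
    rw [mul_pow, ← Polynomial.C_pow, Polynomial.C_mul_X_pow_eq_monomial,
      Polynomial.smul_monomial, Polynomial.smul_eq_C_mul]
  rw [h1, h2, h3] at h
  simp only [Polynomial.finsetSum_coeff, Polynomial.coeff_monomial, Polynomial.coeff_C_mul,
    Polynomial.coeff_map, Finset.sum_ite_eq', Finset.mem_range] at h
  rw [← h]
  split_ifs with hk
  · rfl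
  · rw [Polynomial.coeff_eq_zero_of_natDegree_lt (by omega)]
    simp

lemma trace_mul_coeff_rankPoly {E : Matrix m m S} (hE : E * E = E) (k : ℕ) :
    (E.trace - k) * E.rankPoly.coeff k = 0 := by
  -- Differentiating at `u = 1` turns `u ^ k` into `k` and the polynomial into the trace.
  have h := congrArg (fun p => (Polynomial.derivative p).eval 1) (rankPoly_mul_C_coeff hE k)
  simp only [Polynomial.derivative_mul, Polynomial.derivative_C, mul_zero, add_zero, zero_mul,
    zero_add, Polynomial.eval_mul, Polynomial.eval_C, eval_one_derivative_rankPoly,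
    Polynomial.derivative_X_pow, Polynomial.eval_pow, Polynomial.eval_X, one_pow, mul_one] at h
  rw [sub_mul, h, mul_comm, sub_self]

lemma sum_coeff_rankPoly (E : Matrix m m S) :
    ∑ k ∈ Finset.range (Fintype.card m + 1), E.rankPoly.coeff k = 1 := by
  have h := eval_one_rankPoly E
  rw [Polynomial.eval_eq_sum_range' (Nat.lt_succ_of_le (natDegree_rankPoly_le E))] at h
  simpa using h

variable [Algebra ℂ S]

lemma coeff_rankPoly_eq_zero {E : Matrix m m S} (hE : E * E = E) {d k : ℕ}
    (hd : (E.trace - d) ^ 2 = 0) (hk : k ≠ d) : E.rankPoly.coeff k = 0 := by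
  have hc : (d : ℂ) - k ≠ 0 := by
    rw [sub_ne_zero]
    exact_mod_cast hk.symm
  have hu : IsUnit ((d : S) - k) := by
    simpa using (isUnit_iff_ne_zero.mpr hc).map (algebraMap ℂ S)
  -- `trace E - k` is the nonzero constant `d - k` plus a nilpotent, hence a unit.
  have hn : IsNilpotent (E.trace - d) := ⟨2, hd⟩
  have hu' : IsUnit (E.trace - (k : S)) := by
    have := hn.isUnit_add_left_of_commute hu (Commute.all _ _)
    simpa using this
  exact (hu'.mul_right_eq_zero).mp (trace_mul_coeff_rankPoly hE k)

lemma coeff_rankPoly_eq_one {E : Matrix m m S} (hE : E * E = E) {d : ℕ}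
    (hd : (E.trace - d) ^ 2 = 0) : E.rankPoly.coeff d = 1 := by
  rw [← sum_coeff_rankPoly E]
  by_cases hdm : d ∈ Finset.range (Fintype.card m + 1)
  · exact (Finset.sum_eq_single_of_mem d hdm
      fun k _ hk => coeff_rankPoly_eq_zero hE hd hk).symm
  -- If `d` exceeds the matrix size, every coefficient vanishes and both sides are 0.
  · rw [Polynomial.coeff_eq_zero_of_natDegree_lt
      (lt_of_le_of_lt (natDegree_rankPoly_le E) (by have := mt Finset.mem_range.mpr hdm; omega))]
    exact (Finset.sum_eq_zero fun k hk => coeff_rankPoly_eq_zero hE hd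
      fun h => hdm (h ▸ hk)).symm

lemma trace_eq_natCast_of_sq_eq_zero {E : Matrix m m S} (hE : E * E = E) {d : ℕ}
    (hd : (E.trace - d) ^ 2 = 0) : E.trace = d := by
  have h := trace_mul_coeff_rankPoly hE d
  rwa [coeff_rankPoly_eq_one hE hd, mul_one, sub_eq_zero] at h

lemma eq_zero_of_mul_self_of_trace_eq_zero {E : Matrix m m S} (hE : E * E = E)
    (ht : E.trace = 0) : E = 0 := by
  have h1 : det (1 - E) = 1 := by
    rw [← coeff_zero_rankPoly]
    exact coeff_rankPoly_eq_one hE (by simp [ht])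
  have h2 : IsUnit (1 - E) := (isUnit_iff_isUnit_det _).mpr (by simp [h1])
  have h3 : (1 - E) * E = 0 := by rw [sub_mul, one_mul, hE, sub_self]
  exact (h2.mul_right_eq_zero).mp h3

end Idempotent

/-! ### Symmetric idempotents as row projections -/

section Symmetric

variable {k m S : Type*} [Fintype m] [CommRing S] {P : Matrix m m S}

lemma submatrix_mul_self (hP : P * P = P) (a : k → m) :
    P.submatrix a id * P = P.submatrix a id := by
  ext i j
  exact congrFun (congrFun hP (a i)) j

lemma submatrix_mul_transpose_of_isSymm (hs : P.IsSymm) (hP : P * P = P) (a : k → m) :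
    P.submatrix a id * (P.submatrix a id)ᵀ = P.submatrix a a := by
  rw [transpose_submatrix, hs.eq]
  ext i j
  exact congrFun (congrFun hP (a i)) (a j)

end Symmetric

section Frame

variable {k m S : Type*} [Fintype k] [DecidableEq k] [Fintype m] [CommRing S]

/-- The matrix `Aᵀ (A Aᵀ)⁻¹ A` of the orthogonal projection onto the row space of `A`. -/
noncomputable def rowProj (A : Matrix k m S) : Matrix m m S :=
  Aᵀ * (A * Aᵀ)⁻¹ * A

lemma rowProj_isSymm (A : Matrix k m S) : A.rowProj.IsSymm := by
  simp [rowProj, IsSymm, transpose_nonsing_inv, Matrix.mul_assoc]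

lemma mul_rowProj {A : Matrix k m S} (hA : IsUnit (A * Aᵀ).det) : A * A.rowProj = A := by
  rw [rowProj, ← Matrix.mul_assoc, ← Matrix.mul_assoc, mul_nonsing_inv _ hA, Matrix.one_mul]

lemma rowProj_mul_self {A : Matrix k m S} (hA : IsUnit (A * Aᵀ).det) :
    A.rowProj * A.rowProj = A.rowProj := by
  conv_lhs => rw [rowProj, Matrix.mul_assoc]
  rw [← rowProj, mul_rowProj hA, ← rowProj]

lemma trace_rowProj {A : Matrix k m S} (hA : IsUnit (A * Aᵀ).det) :
    A.rowProj.trace = Fintype.card k := by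
  rw [rowProj, Matrix.mul_assoc, trace_mul_comm, Matrix.mul_assoc, nonsing_inv_mul _ hA, trace_one]

lemma map_rowProj {T : Type*} [CommRing T] (f : S →+* T) {A : Matrix k m S}
    (hA : IsUnit (A * Aᵀ).det) : A.rowProj.map f = (A.map f).rowProj := by
  have h : ((A * Aᵀ)⁻¹).map f = ((A.map f) * (A.map f)ᵀ)⁻¹ := by
    symm
    apply inv_eq_right_inv
    rw [← transpose_map, ← Matrix.map_mul, ← Matrix.map_mul, mul_nonsing_inv _ hA]
    simp
  rw [rowProj, Matrix.map_mul, Matrix.map_mul, h, transpose_map]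
  rfl

variable {P : Matrix m m S}

lemma rowProj_submatrix_eq [DecidableEq m] [Algebra ℂ S] (hs : P.IsSymm) (hP : P * P = P)
    (ht : P.trace = Fintype.card k) (a : k → m) (ha : IsUnit (P.submatrix a a).det) :
    (P.submatrix a id).rowProj = P := by
  have hA : IsUnit (P.submatrix a id * (P.submatrix a id)ᵀ).det := by
    rwa [submatrix_mul_transpose_of_isSymm hs hP]
  have h1 : P.submatrix a id * P = P.submatrix a id := submatrix_mul_self hP a
  have h2 : (P.submatrix a id).rowProj * P = (P.submatrix a id).rowProj := by
    rw [rowProj, Matrix.mul_assoc, h1]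
  have h3 : P * (P.submatrix a id).rowProj = (P.submatrix a id).rowProj := by
    have := congrArg transpose h2
    rwa [transpose_mul, hs.eq, (rowProj_isSymm _).eq] at this
  have h4 := rowProj_mul_self hA
  -- With `Q` the row projection, `PQ = QP = Q`, so `P - Q` is an idempotent of trace 0.
  have h5 : P - (P.submatrix a id).rowProj = 0 := by
    apply eq_zero_of_mul_self_of_trace_eq_zero
    · rw [sub_mul, mul_sub, mul_sub, hP, h2, h3, h4, sub_self, sub_zero]
    · rw [trace_sub, trace_rowProj hA, ht, sub_self]
  exact (sub_eq_zero.mp h5).symm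

end Frame

lemma exists_det_submatrix_ne_zero {K m : Type*} [Field K] [CharZero K] [Fintype m]
    {P : Matrix m m K} (hs : P.IsSymm) (hP : P * P = P) {d : ℕ} (ht : P.trace = d) :
    ∃ a : Fin d → m, (P.submatrix a a).det ≠ 0 := by
  classical
  obtain ⟨κ, a, ha, hspan, hli⟩ := exists_linearIndependent' K P.row
  have : Fintype κ := Fintype.ofInjective a ha
  set A := P.submatrix a id
  have h1 : A * P = A := submatrix_mul_self hP a
  have hli' : LinearIndependent K A.row := hli
  obtain ⟨C, hC⟩ : ∃ C : Matrix m κ K, P = C * A := by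
    have h : ∀ i, ∃ c : κ → K, ∑ j, c j • A.row j = P.row i := fun i => by
      rw [← Submodule.mem_span_range_iff_exists_fun]
      have : P.row i ∈ Submodule.span K (Set.range P.row) := Submodule.subset_span ⟨i, rfl⟩
      rwa [← hspan] at this
    choose c hc using h
    refine ⟨Matrix.of c, ?_⟩
    ext i j
    have := congrFun (hc i) j
    simp only [Finset.sum_apply, Pi.smul_apply, smul_eq_mul, row_apply] at this
    rw [← this]
    simp [Matrix.mul_apply]
  -- The rows of `A` are a basis of the row space of `P`. Since `P = Pᵀ = Aᵀ Cᵀ`, `w A Aᵀ = 0` gives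
  -- `w A = w A P = 0`.
  have hu : IsUnit (A * Aᵀ) := by
    rw [← vecMul_injective_iff_isUnit]
    refine (injective_iff_map_eq_zero (vecMulLinear (A * Aᵀ))).mpr fun w hw => ?_
    have hw0 : w ᵥ* (A * Aᵀ) = 0 := hw
    have hw1 : w ᵥ* A = 0 := by
      have : w ᵥ* A ᵥ* P = 0 := by
        conv_lhs => rw [← hs.eq, hC, transpose_mul]
        rw [← vecMul_vecMul, vecMul_vecMul w A, hw0, zero_vecMul]
      rwa [vecMul_vecMul, h1] at this
    exact (vecMul_injective_iff.mpr hli') (hw1.trans (zero_vecMul A).symm)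
  have hdet : IsUnit (A * Aᵀ).det := (isUnit_iff_isUnit_det _).mp hu
  have hPA : P = A.rowProj := by
    have h2 : P * A.rowProj = P := by
      conv_lhs => rw [hC, Matrix.mul_assoc, mul_rowProj hdet]
      exact hC.symm
    have h3 : A.rowProj * P = A.rowProj := by rw [rowProj, Matrix.mul_assoc, h1]
    have h4 := congrArg transpose h3
    rw [transpose_mul, hs.eq, (rowProj_isSymm _).eq, h2] at h4
    exact h4
  have hcard : Fintype.card κ = d := by
    rw [hPA, trace_rowProj hdet] at ht
    exact_mod_cast ht
  let e : Fin d ≃ κ := (Fintype.equivFinOfCardEq hcard).symm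
  refine ⟨a ∘ e, ?_⟩
  have : P.submatrix (a ∘ e) (a ∘ e) = (P.submatrix a a).submatrix e e := rfl
  rw [this, det_submatrix_equiv_self, ← submatrix_mul_transpose_of_isSymm hs hP]
  exact hdet.ne_zero

end Matrix

lemma genericSymm_isSymm (n : ℕ) : (genericSymm n).IsSymm := by
  ext i j
  simp [genericSymm, Sym2.eq_swap]

/-! ### Maps out of `ℂ[P]` as symmetric matrices -/

section Universal

variable {n : ℕ} {S : Type*} [CommRing S] [Algebra ℂ S]

lemma exists_map_genericSymm_eq {E : Matrix (Fin n) (Fin n) S} (hE : E.IsSymm) :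
    ∃ φ : SymMatRing n →ₐ[ℂ] S, (genericSymm n).map φ = E := by
  refine ⟨MvPolynomial.aeval (Sym2.lift ⟨fun i j => E i j, fun i j => (hE.apply i j).symm⟩), ?_⟩
  ext i j
  simp [genericSymm]

lemma map_genericSymm_injective {φ ψ : SymMatRing n →ₐ[ℂ] S}
    (h : (genericSymm n).map φ = (genericSymm n).map ψ) : φ = ψ := by
  refine MvPolynomial.algHom_ext fun s => ?_
  induction s with
  | _ i j => exact congrFun (congrFun h i) j

lemma idempotentIdeal_le_ker_iff (φ : SymMatRing n →ₐ[ℂ] S) :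
    idempotentIdeal n ≤ RingHom.ker φ ↔
      (genericSymm n).map φ * (genericSymm n).map φ = (genericSymm n).map φ := by
  have h : (genericSymm n).map φ * (genericSymm n).map φ =
      (genericSymm n ^ 2).map φ := by
    rw [sq]
    exact (Matrix.map_mul (f := (φ : SymMatRing n →+* S))).symm
  rw [h, idempotentIdeal, Ideal.span_le]
  constructor
  · intro hle
    ext i j
    have : φ ((genericSymm n ^ 2 - genericSymm n) i j) = 0 := hle ⟨i, j, rfl⟩
    simpa [sub_eq_zero] using this
  · rintro h _ ⟨i, j, rfl⟩
    have := congrFun (congrFun h i) j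
    simpa [RingHom.mem_ker, sub_eq_zero] using this

lemma projectionIdeal_le_ker_iff (d : ℕ) (φ : SymMatRing n →ₐ[ℂ] S) :
    projectionIdeal d n ≤ RingHom.ker φ ↔
      (genericSymm n).map φ * (genericSymm n).map φ = (genericSymm n).map φ ∧
        ((genericSymm n).map φ).trace = d := by
  have h : ((genericSymm n).map φ).trace = φ (genericSymm n).trace := by
    simp [Matrix.trace]
  rw [projectionIdeal, sup_le_iff, idempotentIdeal_le_ker_iff, Ideal.span_singleton_le_iff_mem,
    RingHom.mem_ker, map_sub, map_natCast, sub_eq_zero, h]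

lemma det_submatrix_map {d : ℕ} (φ : SymMatRing n →ₐ[ℂ] S) (a : Fin d → Fin n) :
    (((genericSymm n).map φ).submatrix a a).det = φ ((genericSymm n).submatrix a a).det := by
  rw [AlgHom.map_det]
  rfl

lemma map_genericSymm_isSymm (φ : SymMatRing n →ₐ[ℂ] S) : ((genericSymm n).map φ).IsSymm :=
  (genericSymm_isSymm n).map φ

end Universal

/-! ### Smoothness by infinitesimal lifting -/

/-- Symmetric idempotents lift along surjections with square-zero kernel. -/
lemma exists_isSymm_idempotent_lift {m B : Type*} [Fintype m] [DecidableEq m] [CommRing B]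
    (I : Ideal B) (hI : I ^ 2 = ⊥) {E : Matrix m m (B ⧸ I)} (hs : E.IsSymm) (hE : E * E = E) :
    ∃ F : Matrix m m B, F.IsSymm ∧ F * F = F ∧ F.map (Ideal.Quotient.mk I) = E := by
  classical
  obtain ⟨σ, hσ⟩ := (Ideal.Quotient.mk_surjective (I := I)).hasRightInverse
  set T : Matrix m m B := E.map σ
  have hTs : T.IsSymm := hs.map σ
  have hTE : T.map (Ideal.Quotient.mk I) = E := by
    ext i j
    exact hσ _
  have hN : (T * T - T) * (T * T - T) = 0 := by
    have hmem : ∀ i j, (T * T - T) i j ∈ I := fun i j => by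
      have h0 : (T * T - T).map (Ideal.Quotient.mk I) = 0 := by
        rw [Matrix.map_sub _ (map_sub _), Matrix.map_mul, hTE, hE, sub_self]
      exact Ideal.Quotient.eq_zero_iff_mem.mp (congrFun (congrFun h0 i) j)
    ext i j
    rw [Matrix.mul_apply]
    refine Finset.sum_eq_zero fun k _ => ?_
    have := Ideal.mul_mem_mul (hmem i k) (hmem k j)
    rwa [← sq, hI, Ideal.mem_bot] at this
  -- The Newton correction `3T² - 2T³`, whose idempotency defect is divisible by `(T² - T)²`.
  refine ⟨T * T + T * T + T * T - (T * T * T + T * T * T), ?_, ?_, ?_⟩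
  · simp [Matrix.IsSymm, Matrix.transpose_mul, hTs.eq, Matrix.mul_assoc]
  · have key : (T * T + T * T + T * T - (T * T * T + T * T * T)) *
        (T * T + T * T + T * T - (T * T * T + T * T * T)) -
        (T * T + T * T + T * T - (T * T * T + T * T * T)) =
        (T * T - T) * (T * T - T) * (4 * (T * T) - 4 * T - 3) := by
      noncomm_ring
    rw [hN, zero_mul] at key
    exact sub_eq_zero.mp key
  · rw [Matrix.map_sub _ (map_sub _), Matrix.map_add _ (map_add _), Matrix.map_add _ (map_add _),
      Matrix.map_add _ (map_add _)]
    simp only [Matrix.map_mul, hTE, hE]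
    abel

lemma formallySmooth_quotient_of_lift {σ : Type} (J : Ideal (MvPolynomial σ ℂ))
    (H : ∀ ⦃B : Type⦄ [CommRing B] [Algebra ℂ B] (I : Ideal B), I ^ 2 = ⊥ →
      ∀ φ : MvPolynomial σ ℂ →ₐ[ℂ] B ⧸ I, J ≤ RingHom.ker φ →
      ∃ ψ : MvPolynomial σ ℂ →ₐ[ℂ] B, J ≤ RingHom.ker ψ ∧
        (Ideal.Quotient.mkₐ ℂ I).comp ψ = φ) :
    Algebra.FormallySmooth ℂ (MvPolynomial σ ℂ ⧸ J) := by
  refine Algebra.FormallySmooth.of_comp_surjective fun B _ _ I hI f => ?_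
  obtain ⟨ψ, hψ, hψf⟩ := H I hI (f.comp (Ideal.Quotient.mkₐ ℂ J)) (fun x hx => by
    simp [RingHom.mem_ker, Ideal.Quotient.eq_zero_iff_mem.mpr hx])
  refine ⟨Ideal.Quotient.liftₐ J ψ fun a ha => hψ ha, ?_⟩
  refine Ideal.Quotient.algHom_ext _ ?_
  rw [← hψf]
  rfl

lemma exists_lift_of_idempotentIdeal_le_ker {n : ℕ} {B : Type*} [CommRing B] [Algebra ℂ B]
    (I : Ideal B) (hI : I ^ 2 = ⊥) (φ : SymMatRing n →ₐ[ℂ] B ⧸ I)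
    (hφ : idempotentIdeal n ≤ RingHom.ker φ) :
    ∃ ψ : SymMatRing n →ₐ[ℂ] B, idempotentIdeal n ≤ RingHom.ker ψ ∧
      (Ideal.Quotient.mkₐ ℂ I).comp ψ = φ := by
  obtain ⟨F, hFs, hF, hFφ⟩ := exists_isSymm_idempotent_lift I hI (map_genericSymm_isSymm φ)
    ((idempotentIdeal_le_ker_iff φ).mp hφ)
  obtain ⟨ψ, hψ⟩ := exists_map_genericSymm_eq hFs
  refine ⟨ψ, (idempotentIdeal_le_ker_iff ψ).mpr (by rw [hψ, hF]), map_genericSymm_injective ?_⟩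
  rw [← hFφ, ← hψ]
  rfl

theorem smooth_quotient_idempotentIdeal (n : ℕ) :
    Algebra.Smooth ℂ (SymMatRing n ⧸ idempotentIdeal n) where
  formallySmooth := formallySmooth_quotient_of_lift _ fun _ _ _ I hI φ hφ =>
    exists_lift_of_idempotentIdeal_le_ker I hI φ hφ
  finitePresentation := .quotient (IsNoetherian.noetherian _)

theorem smooth_quotient_projectionIdeal (d n : ℕ) :
    Algebra.Smooth ℂ (SymMatRing n ⧸ projectionIdeal d n) where
  formallySmooth := formallySmooth_quotient_of_lift _ fun B _ _ I hI φ hφ => by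
    obtain ⟨ψ, hψ, rfl⟩ := exists_lift_of_idempotentIdeal_le_ker I hI φ (le_sup_left.trans hφ)
    refine ⟨ψ, (projectionIdeal_le_ker_iff d ψ).mpr ?_, rfl⟩
    have hid := (idempotentIdeal_le_ker_iff ψ).mp hψ
    refine ⟨hid, Matrix.trace_eq_natCast_of_sq_eq_zero hid ?_⟩
    have ht := ((projectionIdeal_le_ker_iff d _).mp hφ).2
    have hmem : ((genericSymm n).map ψ).trace - d ∈ I := by
      rw [← Ideal.Quotient.eq_zero_iff_mem, map_sub, map_natCast, ← ht, sub_eq_zero]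
      simp [Matrix.trace]
    have := Ideal.pow_mem_pow hmem 2
    rwa [hI] at this
  finitePresentation := .quotient (IsNoetherian.noetherian _)

/-! ### Primality through the frame parametrization -/

section Prime

/-- The coordinate ring of the space of `d × n` matrices `A` with `A Aᵀ` invertible. -/
abbrev FrameRing (d n : ℕ) : Type :=
  Localization.Away (Matrix.mvPolynomialX (Fin d) (Fin n) ℂ *
    (Matrix.mvPolynomialX (Fin d) (Fin n) ℂ)ᵀ).det

/-- The universal `d × n` matrix `A` with `A Aᵀ` invertible. -/
noncomputable def genericFrame (d n : ℕ) : Matrix (Fin d) (Fin n) (FrameRing d n) :=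
  (Matrix.mvPolynomialX (Fin d) (Fin n) ℂ).map (algebraMap _ _)

lemma det_map_mul_transpose_map {k m R S : Type*} [Fintype k] [DecidableEq k] [Fintype m]
    [CommRing R] [CommRing S] (f : R →+* S) (A : Matrix k m R) :
    (A.map f * (A.map f)ᵀ).det = f (A * Aᵀ).det := by
  rw [RingHom.map_det, RingHom.mapMatrix_apply, Matrix.map_mul, Matrix.transpose_map]

lemma isUnit_det_genericFrame (d n : ℕ) :
    IsUnit (genericFrame d n * (genericFrame d n)ᵀ).det := by
  rw [genericFrame, det_map_mul_transpose_map]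
  exact IsLocalization.Away.algebraMap_isUnit _

lemma isDomain_frameRing {d n : ℕ} (h : d ≤ n) : IsDomain (FrameRing d n) := by
  refine IsLocalization.isDomain_localization (powers_le_nonZeroDivisors_of_noZeroDivisors ?_)
  intro h0
  -- The first `d` rows of the identity show that `det (A Aᵀ)` is not the zero polynomial.
  let A : Matrix (Fin d) (Fin n) ℂ := (1 : Matrix (Fin n) (Fin n) ℂ).submatrix (Fin.castLE h) id
  have hA : A * Aᵀ = 1 := by
    rw [Matrix.submatrix_mul_transpose_of_isSymm Matrix.isSymm_one (mul_one 1)]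
    exact Matrix.submatrix_one _ (Fin.castLE_injective h)
  let f : MvPolynomial (Fin d × Fin n) ℂ →+* ℂ := MvPolynomial.eval fun p => A p.1 p.2
  have hf : (Matrix.mvPolynomialX (Fin d) (Fin n) ℂ).map f = A := by
    ext i j
    simp [f, Matrix.mvPolynomialX]
  have := det_map_mul_transpose_map f (Matrix.mvPolynomialX (Fin d) (Fin n) ℂ)
  rw [hf, hA, h0, map_zero, Matrix.det_one] at this
  exact one_ne_zero this

lemma exists_map_genericFrame_eq {d n : ℕ} {S : Type*} [CommRing S] [Algebra ℂ S]
    (A : Matrix (Fin d) (Fin n) S) (hA : IsUnit (A * Aᵀ).det) :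
    ∃ ρ : FrameRing d n →ₐ[ℂ] S, (genericFrame d n).map ρ = A := by
  let f : MvPolynomial (Fin d × Fin n) ℂ →ₐ[ℂ] S := MvPolynomial.aeval fun p => A p.1 p.2
  have hf : (Matrix.mvPolynomialX (Fin d) (Fin n) ℂ).map f = A := by
    ext i j
    simp [f, Matrix.mvPolynomialX]
  have hu : IsUnit (f (Matrix.mvPolynomialX (Fin d) (Fin n) ℂ *
      (Matrix.mvPolynomialX (Fin d) (Fin n) ℂ)ᵀ).det) := by
    have := det_map_mul_transpose_map (f : _ →+* S) (Matrix.mvPolynomialX (Fin d) (Fin n) ℂ)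
    rw [show (Matrix.mvPolynomialX (Fin d) (Fin n) ℂ).map (f : _ →+* S) = A from hf] at this
    rw [this] at hA
    exact hA
  refine ⟨IsLocalization.Away.liftAlgHom _ (f := f) hu, ?_⟩
  rw [← hf]
  ext i j
  simp [genericFrame, IsLocalization.Away.lift_eq]

/-- After inverting the minor, the quotient map factors through `φ`, since `P` is the row projection
of its rows `a`; so `f` dies in that localization. -/
lemma exists_pow_mul_mem_projectionIdeal {d n : ℕ} {φ : SymMatRing n →ₐ[ℂ] FrameRing d n}
    (hφ : (genericSymm n).map φ = (genericFrame d n).rowProj) {f : SymMatRing n} (hf : φ f = 0)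
    (a : Fin d → Fin n) :
    ∃ k : ℕ, ((genericSymm n).submatrix a a).det ^ k * f ∈ projectionIdeal d n := by
  let m := ((genericSymm n).submatrix a a).det
  let π := Ideal.Quotient.mkₐ ℂ (projectionIdeal d n)
  let T := Localization.Away (π m)
  let ψ : SymMatRing n →ₐ[ℂ] T := (IsScalarTower.toAlgHom ℂ _ T).comp π
  have hψ : projectionIdeal d n ≤ RingHom.ker ψ := fun x hx => by
    have : π x = 0 := Ideal.Quotient.eq_zero_iff_mem.mpr hx
    simp [ψ, RingHom.mem_ker, this]
  obtain ⟨hP, ht⟩ := (projectionIdeal_le_ker_iff d ψ).mp hψ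
  have hs := map_genericSymm_isSymm ψ
  have hu : IsUnit (((genericSymm n).map ψ).submatrix a a).det := by
    rw [det_submatrix_map]
    exact IsLocalization.Away.algebraMap_isUnit (π m)
  have hrow := Matrix.rowProj_submatrix_eq hs hP (by rw [ht, Fintype.card_fin]) a hu
  obtain ⟨ρ, hρ⟩ := exists_map_genericFrame_eq (((genericSymm n).map ψ).submatrix a id)
    (by rwa [Matrix.submatrix_mul_transpose_of_isSymm hs hP])
  have hcomp : ρ.comp φ = ψ := by
    apply map_genericSymm_injective
    have h1 : (genericSymm n).map (ρ.comp φ) = ((genericSymm n).map φ).map ρ := rfl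
    have h2 := Matrix.map_rowProj (ρ : FrameRing d n →+* T) (isUnit_det_genericFrame d n)
    rw [h1, hφ]
    refine h2.trans ?_
    rw [← hrow, ← hρ]
    rfl
  have hψf : algebraMap _ T (π f) = 0 := by
    have := DFunLike.congr_fun hcomp f
    simpa [hf, ψ] using this.symm
  obtain ⟨⟨_, k, rfl⟩, hk⟩ := (IsLocalization.map_eq_zero_iff (Submonoid.powers (π m)) T _).mp hψf
  refine ⟨k, Ideal.Quotient.eq_zero_iff_mem.mp ?_⟩
  simpa [π] using hk

theorem projectionIdeal_isPrime {d n : ℕ} (h : d ≤ n) : (projectionIdeal d n).IsPrime := by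
  have := isDomain_frameRing h
  have hu := isUnit_det_genericFrame d n
  obtain ⟨φ, hφ⟩ := exists_map_genericSymm_eq (genericFrame d n).rowProj_isSymm
  suffices hker : projectionIdeal d n = RingHom.ker φ by
    rw [hker]
    exact RingHom.ker_isPrime _
  refine le_antisymm ((projectionIdeal_le_ker_iff d φ).mpr ?_) fun f hf => ?_
  · rw [hφ]
    exact ⟨Matrix.rowProj_mul_self hu, by rw [Matrix.trace_rowProj hu, Fintype.card_fin]⟩
  by_contra hfJ
  -- Were this colon ideal proper, a maximal ideal above it would contain every principal `d × d`
  -- minor, but some minor is nonzero in the residue field.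
  let Q : Ideal (SymMatRing n) := (projectionIdeal d n).colon {f}
  have hQ : Q ≠ ⊤ := fun hQ => hfJ <| by
    have : (1 : SymMatRing n) ∈ Q := hQ ▸ Submodule.mem_top
    simpa [Q, Submodule.mem_colon_singleton] using this
  obtain ⟨M, hM, hQM⟩ := Ideal.exists_le_maximal Q hQ
  let π := Ideal.Quotient.mkₐ ℂ M
  let : Field (SymMatRing n ⧸ M) := Ideal.Quotient.field M
  have : CharZero (SymMatRing n ⧸ M) := algebraRat.charZero _
  have hπ : projectionIdeal d n ≤ RingHom.ker π := fun x hx => by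
    rw [RingHom.mem_ker]
    refine Ideal.Quotient.eq_zero_iff_mem.mpr (hQM ?_)
    rw [Submodule.mem_colon_singleton]
    exact Ideal.mul_mem_right _ _ hx
  obtain ⟨hP, ht⟩ := (projectionIdeal_le_ker_iff d π).mp hπ
  obtain ⟨a, ha⟩ := Matrix.exists_det_submatrix_ne_zero (map_genericSymm_isSymm π) hP ht
  obtain ⟨k, hk⟩ := exists_pow_mul_mem_projectionIdeal hφ hf a
  have hkM : ((genericSymm n).submatrix a a).det ^ k ∈ M :=
    hQM (Submodule.mem_colon_singleton.mpr hk)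
  apply ha
  rw [det_submatrix_map]
  exact Ideal.Quotient.eq_zero_iff_mem.mpr (hM.isPrime.mem_of_pow_mem k hkM)

end Prime

/-! ### Radicality and conclusion -/

theorem idempotentIdeal_isRadical (n : ℕ) : (idempotentIdeal n).IsRadical := by
  intro f hf
  let π := Ideal.Quotient.mkₐ ℂ (idempotentIdeal n)
  have hker : RingHom.ker π = idempotentIdeal n := Ideal.Quotient.mkₐ_ker ℂ _
  set E := (genericSymm n).map π
  have hE : E * E = E := (idempotentIdeal_le_ker_iff π).mp hker.ge
  have htr : E.trace = π (genericSymm n).trace := by simp [E, Matrix.trace]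
  -- Write `1 = ∑ e_k`. Modulo `I_n`, `f` is a multiple of `trace P - k`, which `e_k` kills.
  rw [← hker, RingHom.mem_ker, ← mul_one (π f), ← Matrix.sum_coeff_rankPoly E, Finset.mul_sum]
  refine Finset.sum_eq_zero fun k hk => ?_
  have hkn : k ≤ n := by simpa [Nat.lt_succ_iff] using hk
  have hfk : f ∈ projectionIdeal k n :=
    (projectionIdeal_isPrime hkn).isRadical (Ideal.radical_mono le_sup_left hf)
  obtain ⟨x, hx, y, hy, rfl⟩ := Submodule.mem_sup.mp hfk
  obtain ⟨z, rfl⟩ := Ideal.mem_span_singleton'.mp hy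
  have hx0 : π x = 0 := Ideal.Quotient.eq_zero_iff_mem.mpr hx
  rw [map_add, hx0, zero_add, map_mul, map_sub, map_natCast, ← htr, mul_assoc,
    Matrix.trace_mul_coeff_rankPoly hE, mul_zero]

theorem mainTheorem2 (n : ℕ) :
    (idempotentIdeal n).IsRadical ∧
    Algebra.Smooth ℂ (SymMatRing n ⧸ idempotentIdeal n) ∧
    ∀ d : ℕ, d ≤ n →
      (projectionIdeal d n).IsPrime ∧
      MvPolynomial.vanishingIdeal ℂ (pGr d n) = projectionIdeal d n ∧
      Algebra.Smooth ℂ (SymMatRing n ⧸ projectionIdeal d n) := by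
  refine ⟨idempotentIdeal_isRadical n, smooth_quotient_idempotentIdeal n, fun d hd => ?_⟩
  have hp := projectionIdeal_isPrime hd
  refine ⟨hp, ?_, smooth_quotient_projectionIdeal d n⟩
  rw [pGr, MvPolynomial.vanishingIdeal_zeroLocus_eq_radical, hp.radical]
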